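/- **Label complexity of Active Cover in the realizable case.** *Setting.* Let $\mathcal D$ be a probability distribution on $\mathcal X\times\{\pm1\}$ with marginal $\mathcal D_X$, let $\mathcal H\subseteq\{\pm1\}^{\mathcal X}$ be a finite set of measurable classifiers, $\mathrm{err}(h)=\Pr_{(X,Y)\sim\mathcal D}(h(X)\ne Y)$, and $h^*\in\arg\min_{h\in\mathcal H}\mathrm{err}(h)$. For a finite multiset $S$ of weighted examples $(x,y,w)$ put $\mathrm{err}(h,S)=\frac1{|S|}\sum_{(x,y,w)\in S}w\,\mathbf 1(h(x)\ne y)$ (and $0$ if $S=\emptyset$). For $A\subseteq\mathcal H$ let $\mathrm{DIS}(A)=\{x:\exists h,h'\in A,\ h(x)\ne h'(x)\}$. The disagreement coefficient is $$\theta=\sup_{r>0}\frac1r\,\mathcal D_X\{x:\exists h\in\mathcal H,\ h(x)\ne h^*(x),\ \mathcal D_X\{x':h(x')\ne h^*(x')\}\le r\}.$$ *Algorithm.* Active Cover has as input an epoch schedule $0=\tau_0<3=\tau_1<\tau_2<\dots<\tau_M=n$ ($M\ge1$) with $\tau_{m+1}\le2\tau_m$ for $m\ge1$, a confidence $\delta$,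 and constants $c_1,c_2,c_3,\gamma,\alpha,\beta,\xi$. Put $\epsilon_m=32(\log(|\mathcal H|/\delta)+\log\tau_m)/\tau_m$. The constants satisfy, for some $\eta\ge864$, $$\alpha\ge1,\quad 0\le\xi\le\tfrac1{8n\epsilon_M\log n},\quad \beta^2\le\tfrac{\eta}{864\,\gamma n\epsilon_M\log n},\quad \gamma\ge\tfrac\eta4,\quad c_1\ge2\alpha\sqrt6,\quad c_2\ge\tfrac{\eta c_1^2}{4},\quad c_3\ge1 .$$ Examples $(X_i,Y_i)$, $i=1,\dots,n$, are drawn i.i.d. from $\mathcal D$; epoch $m$ consists of the examples $\tau_{m-1}<i\le\tau_m$. In epoch $1$ all three labels are queried, and $\tilde Z_1=\{(X_i,Y_i,1):i\le3\}$. For $m\ge1$, at the end of epoch $m<M$ the algorithm computes from the sample $\tilde Z_m$ an empirical error minimizer $h_{m+1}\in\arg\min_{h\in\mathcal H}\mathrm{err}(h,\tilde Z_m)$ and $$\Delta_m=c_1\sqrt{\epsilon_m\,\mathrm{err}(h_{m+1},\tilde Z_m)}+c_2\epsilon_m\log\tau_m,\qquad A_{m+1}=\{h\in\mathcal H:\mathrm{err}(h,\tilde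 Z_m)-\mathrm{err}(h_{m+1},\tilde Z_m)\le\gamma\Delta_m\},$$ $D_{m+1}=\mathrm{DIS}(A_{m+1})$, and a query probability function $P_{m+1}:\mathcal X\to[0,1]$ that minimizes $\mathbb E_X[1/(1-P(X))]$ over all measurable $P:\mathcal X\to[0,1]$ with $$\mathbb E_X\Big[\tfrac{\mathbf 1(h(X)\ne h_{m+1}(X)\wedge X\in D_{m+1})}{P(X)}\Big]\le b_{m+1}(h)\ \ \forall h\in\mathcal H,\qquad P(x)\ge P_{\min,m+1}\ \ \forall x\in D_{m+1},$$ where $$b_{m+1}(h)=2\alpha^2\Pr_X(h(X)\ne h_{m+1}(X)\wedge X\in D_{m+1})+2\beta^2\gamma\big(\mathrm{err}(h,\tilde Z_m)-\mathrm{err}(h_{m+1},\tilde Z_m)\big)\tau_m\Delta_m+\xi\tau_m\Delta_m^2,$$ $$P_{\min,m+1}=\min\Big(\frac{c_3}{\sqrt{\tau_m\,\mathrm{err}(h_{m+1},\tilde Z_m)/(n\epsilon_M)}+\log\tau_m},\ \frac12\Big).$$ For each example $i$ of epoch $j=m+1\ge2$: if $X_i\in D_j$, the label $Y_i$ is queried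 with probability $P_j(X_i)$ (independently of everything else), and $(X_i,Y_i,1/P_j(X_i))$ is added to the sample if it is queried, $(X_i,1,0)$ if it is not; if $X_i\notin D_j$, the label is not queried and $(X_i,h_j(X_i),1)$ is added. The result is $\tilde Z_j\supseteq\tilde Z_{j-1}$. Ties between minimizers may be broken in any non-anticipating measurable way. *Claim.* There is a universal constant $C>0$ such that, whenever $0<\delta<1/e$, $|\mathcal H|/\delta>\sqrt{192}$ and $\mathrm{err}(h^*)=0$, the expected number of labels queried by Active Cover on the $n$ examples is at most $$3+\theta\cdot C\,\gamma\,c_2\Big(\log\frac{|\mathcal H|}{\delta}\,\log^2 n+\log^3 n\Big)=3+\theta\cdot\tilde O\big(\log(|\mathcal H|/\delta)\big).$$ (The $3$ counts the first three labels, which are always queried; it can be dropped unless $\theta=0$, since otherwise $\theta\ge1$.) -/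

import Mathlib

open MeasureTheory ProbabilityTheory
open scoped ENNReal

namespace ActiveCover

noncomputable section

/-! ### Classifiers, errors, disagreement

A binary label is a `Bool`: `true` stands for `+1` and `false` for `-1`. -/

/-- The expected error `err(h) = Pr_{(X,Y) ∼ 𝒟}(h(X) ≠ Y)`. -/
def trueErr {𝒳 : Type*} [MeasurableSpace 𝒳] (𝒟 : Measure (𝒳 × Bool)) (h : 𝒳 → Bool) : ℝ :=
  𝒟.real {z | h z.1 ≠ z.2}

/-- The importance weighted empirical error `err(h, S) = ∑_{(x,y,w) ∈ S} w · 1(h(x) ≠ y) / |S|`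
of `h` on a multiset `S` of weighted labeled examples. -/
def empErr {𝒳 : Type*} (h : 𝒳 → Bool) (S : Multiset (𝒳 × Bool × ℝ)) : ℝ :=
  (S.map fun e => if h e.1 ≠ e.2.1 then e.2.2 else 0).sum / (Multiset.card S : ℝ)

/-- The disagreement region `DIS(A)` of a set `A` of classifiers. -/
def DIS {𝒳 : Type*} (A : Set (𝒳 → Bool)) : Set 𝒳 :=
  {x | ∃ h ∈ A, ∃ h' ∈ A, h x ≠ h' x}

/-- The disagreement coefficient `θ(h*)` of the class `H` under the marginal `μX`, that is
`sup_{r > 0} μX {x | ∃ h ∈ H, h*(x) ≠ h(x), μX {x' | h(x') ≠ h*(x')} ≤ r} / r`. -/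
def disagreementCoeff {𝒳 : Type*} [MeasurableSpace 𝒳] (μX : Measure 𝒳)
    (H : Finset (𝒳 → Bool)) (hstar : 𝒳 → Bool) : ℝ≥0∞ :=
  ⨆ (r : ℝ) (_ : 0 < r),
    μX {x | ∃ h ∈ H, hstar x ≠ h x ∧ μX {x' | h x' ≠ hstar x'} ≤ ENNReal.ofReal r}
      / ENNReal.ofReal r

/-! ### Input of the algorithm -/

/-- The input of Active Cover: the constants `c₁, c₂, c₃`, the confidence `δ`, the error radius `γ`,
the parameters `α, β, ξ` of the optimization problem, the constant `η` that occurs in the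
conditions on the others, the number `M` of epochs and the epoch schedule `τ`. -/
structure Params where
  c₁ : ℝ
  c₂ : ℝ
  c₃ : ℝ
  δ : ℝ
  γ : ℝ
  α : ℝ
  β : ℝ
  ξ : ℝ
  η : ℝ
  M : ℕ
  τ : ℕ → ℕ

namespace Params

variable (prm : Params)

/-- The number of examples, `n = τ_M`. -/
def n : ℕ := prm.τ prm.M

/-- `ε_m = 32 (log(|H|/δ) + log τ_m) / τ_m`, where `k = |H|`. -/
def eps (k m : ℕ) : ℝ :=
  32 * (Real.log ((k : ℝ) / prm.δ) + Real.log (prm.τ m)) / (prm.τ m : ℝ)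

/-- `0 = τ_0 < 3 = τ_1 < τ_2 < ⋯ < τ_M` and `τ_{m+1} ≤ 2 τ_m` for `m ≥ 1`. -/
structure ValidSchedule : Prop where
  one_le_M : 1 ≤ prm.M
  zero : prm.τ 0 = 0
  one : prm.τ 1 = 3
  lt_succ : ∀ m, m < prm.M → prm.τ m < prm.τ (m + 1)
  succ_le : ∀ m, 1 ≤ m → m < prm.M → prm.τ (m + 1) ≤ 2 * prm.τ m

/-- The conditions that the constants have to satisfy, where `k = |H|`. -/
structure ValidConstants (k : ℕ) : Prop where
  alpha : 1 ≤ prm.α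
  eta : 864 ≤ prm.η
  xi_nonneg : 0 ≤ prm.ξ
  xi : prm.ξ ≤ 1 / (8 * (prm.n : ℝ) * prm.eps k prm.M * Real.log prm.n)
  beta : prm.β ^ 2 ≤ prm.η / (864 * prm.γ * (prm.n : ℝ) * prm.eps k prm.M * Real.log prm.n)
  gamma : prm.η / 4 ≤ prm.γ
  c₁ : 2 * prm.α * Real.sqrt 6 ≤ prm.c₁
  c₂ : prm.η * prm.c₁ ^ 2 / 4 ≤ prm.c₂
  c₃ : 1 ≤ prm.c₃

end Params

/-! ### One execution of the algorithm -/

/-- The data of one execution, examples and epochs being numbered from `1`: the `i`-th example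
`(x i, y i)`, the number `u i ∈ [0, 1]` that realizes the `i`-th Bernoulli draw, the classifier `h m`
and the query probability function `P m` of epoch `m`. -/
structure Path (𝒳 : Type*) where
  x : ℕ → 𝒳
  y : ℕ → Bool
  u : ℕ → ℝ
  h : ℕ → 𝒳 → Bool
  P : ℕ → 𝒳 → ℝ

section Execution

variable {𝒳 : Type*} (prm : Params) (H : Finset (𝒳 → Bool))

/-- The threshold `Δ_m`, as a function of the sample `Z = Z̃_m` and its empirical error minimizer
`g = h_{m+1}`: `Δ_0 = c₁ √ε_1 + c₂ ε_1 log 3` and, for `m ≥ 1`,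
`Δ_m = c₁ √(ε_m err(h_{m+1}, Z̃_m)) + c₂ ε_m log τ_m`. -/
def threshold (m : ℕ) (Z : Multiset (𝒳 × Bool × ℝ)) (g : 𝒳 → Bool) : ℝ :=
  if m = 0 then
    prm.c₁ * Real.sqrt (prm.eps H.card 1) + prm.c₂ * prm.eps H.card 1 * Real.log 3
  else
    prm.c₁ * Real.sqrt (prm.eps H.card m * empErr g Z)
      + prm.c₂ * prm.eps H.card m * Real.log (prm.τ m)

/-- `A_{m+1} = {h ∈ H | err(h, Z̃_m) - err(h_{m+1}, Z̃_m) ≤ γ Δ_m}` for `Z = Z̃_m`, `g = h_{m+1}`. -/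
def goodSet (m : ℕ) (Z : Multiset (𝒳 × Bool × ℝ)) (g : 𝒳 → Bool) : Set (𝒳 → Bool) :=
  {h | h ∈ H ∧ empErr h Z - empErr g Z ≤ prm.γ * threshold prm H m Z g}

/-- The label of example `i`, which belongs to epoch `j` with disagreement region `D`, is queried.
The labels of epoch `1` (the first three examples) are always queried; later the label is queried
if `x_i ∈ D` and the Bernoulli draw with success probability `P_j(x_i)` succeeds. -/
def Queried (π : Path 𝒳) (j : ℕ) (D : Set 𝒳) (i : ℕ) : Prop :=
  j = 1 ∨ (π.x i ∈ D ∧ π.u i < π.P j (π.x i))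

open Classical in
/-- The weighted example that is added to the sample after example `i` of epoch `j`. -/
def weightedExample (π : Path 𝒳) (j : ℕ) (D : Set 𝒳) (i : ℕ) : 𝒳 × Bool × ℝ :=
  if j = 1 then (π.x i, π.y i, 1)
  else if π.x i ∈ D then
    if Queried π j D i then (π.x i, π.y i, 1 / π.P j (π.x i)) else (π.x i, true, 0)
  else (π.x i, π.h j (π.x i), 1)

/-- The sample `Z̃_m` at the end of epoch `m`. Epoch `m + 1` consists of the examples
`τ_m + 1, …, τ_{m+1}` and has the disagreement region `D_{m+1} = DIS(A_{m+1})`. -/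
def sample (π : Path 𝒳) : ℕ → Multiset (𝒳 × Bool × ℝ)
  | 0 => 0
  | m + 1 => sample π m + (Finset.Ioc (prm.τ m) (prm.τ (m + 1))).val.map
      (weightedExample π (m + 1) (DIS (goodSet prm H m (sample π m) (π.h (m + 1)))))

/-- The disagreement region `D_{m+1} = DIS(A_{m+1})` of epoch `m + 1`. -/
def regionSucc (π : Path 𝒳) (m : ℕ) : Set 𝒳 :=
  DIS (goodSet prm H m (sample prm H π m) (π.h (m + 1)))

/-- `Δ_m` along the execution. -/
def delta (π : Path 𝒳) (m : ℕ) : ℝ :=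
  threshold prm H m (sample prm H π m) (π.h (m + 1))

open Classical in
/-- The number of labels queried during epochs `1, …, M`, that is, on examples `1, …, n`. -/
def numQueries (π : Path 𝒳) : ℕ :=
  ∑ m ∈ Finset.range prm.M,
    ((Finset.Ioc (prm.τ m) (prm.τ (m + 1))).filter
      (Queried π (m + 1) (regionSucc prm H π m))).card

/-- `h_{m+1}` minimizes the empirical error on `Z̃_m` over `H`. -/
def IsERMSucc (π : Path 𝒳) (m : ℕ) : Prop :=
  π.h (m + 1) ∈ H ∧
    ∀ g ∈ H, empErr (π.h (m + 1)) (sample prm H π m) ≤ empErr g (sample prm H π m)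

/-- The minimum query probability `P_{min,m+1}`, for `m ≥ 1`. -/
def pMinSucc (π : Path 𝒳) (m : ℕ) : ℝ :=
  min (prm.c₃ /
    (Real.sqrt ((prm.τ m : ℝ) * empErr (π.h (m + 1)) (sample prm H π m)
        / ((prm.n : ℝ) * prm.eps H.card prm.M))
      + Real.log (prm.τ m))) (1 / 2)

variable [MeasurableSpace 𝒳] (μX : Measure 𝒳)

/-- The right-hand side `b_{m+1}(h)` of the variance constraint, for `m ≥ 1`. -/
def varBoundSucc (π : Path 𝒳) (m : ℕ) (h : 𝒳 → Bool) : ℝ :=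
  2 * prm.α ^ 2 * μX.real {x | h x ≠ π.h (m + 1) x ∧ x ∈ regionSucc prm H π m}
    + 2 * prm.β ^ 2 * prm.γ
      * (empErr h (sample prm H π m) - empErr (π.h (m + 1)) (sample prm H π m))
      * (prm.τ m : ℝ) * delta prm H π m
    + prm.ξ * (prm.τ m : ℝ) * delta prm H π m ^ 2

/-- The constraints of the optimization problem that defines `P_{m+1}`. On the set
`{h ≠ h_{m+1}} ∩ D_{m+1}` of the variance constraint the function `p` is positive. -/
structure OPFeasibleSucc (π : Path 𝒳) (m : ℕ) (p : 𝒳 → ℝ) : Prop where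
  measurable : Measurable p
  mem_unit : ∀ x, 0 ≤ p x ∧ p x ≤ 1
  pMin_le : ∀ x ∈ regionSucc prm H π m, pMinSucc prm H π m ≤ p x
  variance : ∀ h ∈ H,
    ∫⁻ x in {x | h x ≠ π.h (m + 1) x ∧ x ∈ regionSucc prm H π m}, (ENNReal.ofReal (p x))⁻¹ ∂μX
      ≤ ENNReal.ofReal (varBoundSucc prm H μX π m h)

/-- The objective `E_X[1 / (1 - p(X))]`, with `1 / 0 = ∞`. -/
def opObjective (p : 𝒳 → ℝ) : ℝ≥0∞ :=
  ∫⁻ x, (ENNReal.ofReal (1 - p x))⁻¹ ∂μX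

/-- `P_{m+1}` is a solution of the optimization problem of epoch `m + 1`. -/
def IsOPSolutionSucc (π : Path 𝒳) (m : ℕ) : Prop :=
  OPFeasibleSucc prm H μX π m (π.P (m + 1)) ∧
    ∀ p, OPFeasibleSucc prm H μX π m p → opObjective μX (π.P (m + 1)) ≤ opObjective μX p

end Execution

/-! ### The random execution -/

/-- A run of Active Cover on i.i.d. examples from `𝒟`, on a probability space `(Ω, ρ)`.
`𝓕 i` is the information available after `i` examples. Example `i + 1`, together with an independent
uniform random number that realizes its Bernoulli draw, is independent of `𝓕 i`. The epoch-`(m+1)`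
classifier and query probability function are determined from `𝓕 (τ_m)`: the first is an empirical
error minimizer (ties broken in any way), the second a solution of the optimization problem. In
epoch `1` every label is queried, so neither is needed there. -/
structure Run {𝒳 : Type*} [MeasurableSpace 𝒳] (prm : Params) (H : Finset (𝒳 → Bool))
    (𝒟 : Measure (𝒳 × Bool)) {Ω : Type*} [mΩ : MeasurableSpace Ω] (ρ : Measure Ω) where
  𝓕 : Filtration ℕ mΩ
  X : ℕ → Ω → 𝒳
  Y : ℕ → Ω → Bool
  U : ℕ → Ω → ℝ
  h : ℕ → Ω → H
  P : ℕ → Ω → 𝒳 → ℝ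
  measurable_example : ∀ i, Measurable[𝓕 (i + 1)]
    (fun ω => ((X (i + 1) ω, Y (i + 1) ω), U (i + 1) ω))
  law_example : ∀ i, ρ.map (fun ω => ((X (i + 1) ω, Y (i + 1) ω), U (i + 1) ω))
    = 𝒟.prod (volume.restrict (Set.Icc (0 : ℝ) 1))
  indep_example : ∀ i, Indep
    (MeasurableSpace.comap (fun ω => ((X (i + 1) ω, Y (i + 1) ω), U (i + 1) ω)) inferInstance)
    (𝓕 i) ρ
  measurable_h : ∀ m, 1 ≤ m → m < prm.M → Measurable[𝓕 (prm.τ m), ⊤] (h (m + 1))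
  measurable_P : ∀ m, 1 ≤ m → m < prm.M →
    Measurable[(𝓕 (prm.τ m)).prod inferInstance] (fun q : Ω × 𝒳 => P (m + 1) q.1 q.2)
  erm : ∀ m, 1 ≤ m → m < prm.M → ∀ ω, IsERMSucc prm H
    ⟨fun i => X i ω, fun i => Y i ω, fun i => U i ω, fun j => (h j ω).1, fun j => P j ω⟩ m
  solves : ∀ m, 1 ≤ m → m < prm.M → ∀ ω, IsOPSolutionSucc prm H 𝒟.fst
    ⟨fun i => X i ω, fun i => Y i ω, fun i => U i ω, fun j => (h j ω).1, fun j => P j ω⟩ m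

namespace Run

variable {𝒳 : Type*} [MeasurableSpace 𝒳] {prm : Params} {H : Finset (𝒳 → Bool)}
  {𝒟 : Measure (𝒳 × Bool)} {Ω : Type*} [MeasurableSpace Ω] {ρ : Measure Ω}

/-- The execution at the sample point `ω`. -/
def path (R : Run prm H 𝒟 ρ) (ω : Ω) : Path 𝒳 :=
  ⟨fun i => R.X i ω, fun i => R.Y i ω, fun i => R.U i ω, fun j => (R.h j ω).1, fun j => R.P j ω⟩

/-- The expected number of label queries. -/
def expectedQueries (R : Run prm H 𝒟 ρ) : ℝ≥0∞ :=
  ∫⁻ ω, (numQueries prm H (R.path ω) : ℝ≥0∞) ∂ρ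

end Run

end

end ActiveCover

/-! In the realizable case almost every run carries only labels of `hstar`. By induction over the
epochs `hstar` never makes a mistake on the sample, so the empirical minimum is zero, the
square-root term of the threshold vanishes, and `γ Δ_m` is the deterministic `radius`. Labels
inferred outside the disagreement region are correct, because both `hstar` and the empirical
minimizer survive. Hence the empirical error of `h` is an inverse propensity weighted frequency of
`{h ≠ hstar}` (`weightedSum_sample`), and the optimization problem enters through `P_min ≤ P ≤ 1`,
where now `P_min ≥ 1 / (2 log τ_m)`.

Put `B = 2 log τ_m` and let `p` be the mass of `{h ≠ hstar}`. Each example multiplies the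
expectation of `exp (-mistakes / B)` by at most `exp (-p / (2B))` (`lintegral_mul_exp_sum_ipw_le`).
By Markov's inequality a classifier with `p > 4 radius` survives epoch `m` with probability at most
`δ / (|H| τ_m)` (`measure_survives_le`).

Outside this failure event, queries of epoch `m + 1` fall in the disagreement region of the ball of
radius `4 radius`, of mass at most `4 θ radius`. The failure probability is also charged to `θ`,
since `θ ≥ 1` as soon as failure is possible (`measure_overlooked_le`). So a query has probability
of order `θ γ c₂ (log(|H|/δ) + log n) log n / τ_m`, and the sum of `(τ_{m+1} - τ_m) / τ_m`
contributes one more `log n` (`sum_ratio_le`). -/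

namespace ActiveCover

/-! ### Integration against independent variables. -/

/-- Freezing an independent variable. -/
theorem lintegral_comp_of_indepFun {Ω E Ξ : Type*} [MeasurableSpace Ω] [MeasurableSpace E]
    [MeasurableSpace Ξ] {ρ : Measure Ω} [IsProbabilityMeasure ρ] {T : Ω → E} {ξ : Ω → Ξ}
    (hT : Measurable T) (hξ : Measurable ξ) (hind : IndepFun T ξ ρ) {f : E × Ξ → ℝ≥0∞}
    (hf : Measurable f) :
    ∫⁻ ω, f (T ω, ξ ω) ∂ρ = ∫⁻ ω, ∫⁻ z, f (T ω, z) ∂(ρ.map ξ) ∂ρ := by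
  have h1 := (indepFun_iff_map_prod_eq_prod_map_map hT.aemeasurable hξ.aemeasurable).1 hind
  have : IsProbabilityMeasure (ρ.map ξ) := Measure.isProbabilityMeasure_map hξ.aemeasurable
  rw [← lintegral_map hf (hT.prodMk hξ), h1, lintegral_prod _ hf.aemeasurable,
    lintegral_map hf.lintegral_prod_right' hT]

/-- Freezing a variable that is independent of a sub-σ-algebra. -/
theorem lintegral_comp_of_indep {Ω Ξ : Type*} {m : MeasurableSpace Ω} [mΩ : MeasurableSpace Ω]
    [mΞ : MeasurableSpace Ξ] {ρ : Measure Ω} [IsProbabilityMeasure ρ]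
    (hm : m ≤ mΩ) {ξ : Ω → Ξ} (hξ : Measurable ξ)
    (hind : Indep (MeasurableSpace.comap ξ mΞ) m ρ) {f : Ω × Ξ → ℝ≥0∞}
    (hf : Measurable[m.prod mΞ] f) :
    ∫⁻ ω, f (ω, ξ ω) ∂ρ = ∫⁻ ω, ∫⁻ z, f (ω, z) ∂(ρ.map ξ) ∂ρ := by
  -- The sub-σ-algebra is encoded as the identity map from `(Ω, mΩ)` to `(Ω, m)`.
  refine @lintegral_comp_of_indepFun Ω Ω Ξ mΩ m mΞ ρ _ id ξ (measurable_id'' hm) hξ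
    ((@IndepFun_iff_Indep Ω Ω Ξ mΩ m mΞ id ξ ρ).2 ?_) f hf
  rw [MeasurableSpace.comap_id]
  exact hind.symm

/-! ### Exponential moments of inverse propensity weighted sums. -/

/-- The inverse propensity weighted indicator of `E` at the example `z = ((x, y), u)`, where the
Bernoulli draw with success probability `q x` is realized by `u`. -/
noncomputable def ipw {𝒳 : Type*} (E : Set 𝒳) (q : 𝒳 → ℝ) (z : (𝒳 × Bool) × ℝ) : ℝ :=
  E.indicator (fun x => if z.2 < q x then 1 / q x else 0) z.1.1

/-- Since `exp s ≥ 1 + s`, it suffices that `(1 + s)(1 - s/2) ≥ 1`, which holds on `[0, 1]`. -/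
theorem exp_neg_le_one_sub_half {s : ℝ} (h0 : 0 ≤ s) (h1 : s ≤ 1) :
    Real.exp (-s) ≤ 1 - s / 2 := by
  rw [Real.exp_neg, inv_le_comm₀ (Real.exp_pos _) (by linarith)]
  refine le_trans ?_ (Real.add_one_le_exp s)
  rw [inv_le_iff_one_le_mul₀ (by linarith)]
  nlinarith

/-- With `s = 1/(Bq) ≤ 1` the integral is `q exp(-s) + 1 - q ≤ 1 - q s / 2`. The probability `q`
cancels, so the bound depends on `B` alone. -/
theorem lintegral_exp_bernoulli_le {B q : ℝ} (hB : 1 ≤ B) (hq : 1 / B ≤ q) (hq1 : q ≤ 1) :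
    ∫⁻ u in Set.Icc (0 : ℝ) 1, ENNReal.ofReal (Real.exp (-(1 / B * if u < q then 1 / q else 0)))
      ≤ ENNReal.ofReal (1 - 1 / (2 * B)) := by
  have hB0 : 0 < B := by linarith
  have hq0 : 0 < q := lt_of_lt_of_le (by positivity) hq
  have hs : 1 / (B * q) ≤ 1 := by
    rw [div_le_iff₀ (by positivity)]
    rw [div_le_iff₀ hB0] at hq
    linarith
  rw [← lintegral_inter_add_sdiff _ (Set.Icc (0 : ℝ) 1) (measurableSet_Iio (a := q))]
  have e1 : ∫⁻ u in Set.Icc (0 : ℝ) 1 ∩ Set.Iio q,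
      ENNReal.ofReal (Real.exp (-(1 / B * if u < q then 1 / q else 0)))
      ≤ ENNReal.ofReal ((1 - 1 / (B * q) / 2) * q) := by
    rw [setLIntegral_congr_fun (g := fun _ => ENNReal.ofReal (Real.exp (-(1 / (B * q)))))
      (measurableSet_Icc.inter measurableSet_Iio)]
    · rw [setLIntegral_const, ENNReal.ofReal_mul (by linarith)]
      gcongr
      · exact exp_neg_le_one_sub_half (by positivity) hs
      · refine (measure_mono (t := Set.Ico 0 q) fun u hu => ⟨hu.1.1, hu.2⟩).trans ?_
        simp
    · intro u hu
      have : u < q := hu.2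
      simp only [this, if_true]
      congr 3
      field_simp
  have e2 : ∫⁻ u in Set.Icc (0 : ℝ) 1 \ Set.Iio q,
      ENNReal.ofReal (Real.exp (-(1 / B * if u < q then 1 / q else 0)))
      ≤ ENNReal.ofReal (1 - q) := by
    rw [setLIntegral_congr_fun (g := fun _ => 1)
      (measurableSet_Icc.diff measurableSet_Iio)]
    · rw [setLIntegral_const, one_mul]
      refine (measure_mono (t := Set.Icc q 1) fun u hu => ⟨not_lt.1 hu.2, hu.1.2⟩).trans ?_
      simp
    · intro u hu
      have : ¬ u < q := hu.2
      simp [this]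
  refine (add_le_add e1 e2).trans ?_
  rw [← ENNReal.ofReal_add (by nlinarith) (by linarith)]
  apply ENNReal.ofReal_le_ofReal
  apply le_of_eq
  field_simp
  ring

variable {𝒳 : Type*} [MeasurableSpace 𝒳]

theorem measurable_ipw {Ω : Type*} {m : MeasurableSpace Ω} {E : Set 𝒳} (hE : MeasurableSet E)
    {q : Ω × 𝒳 → ℝ} (hq : Measurable q) :
    Measurable fun a : Ω × ((𝒳 × Bool) × ℝ) => ipw E (fun x => q (a.1, x)) a.2 := by
  classical
  have h2 : Measurable fun a : Ω × ((𝒳 × Bool) × ℝ) => q (a.1, a.2.1.1) :=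
    hq.comp (by fun_prop)
  unfold ipw
  simp only [Set.indicator_apply]
  refine Measurable.ite ((show Measurable fun a : Ω × ((𝒳 × Bool) × ℝ) => a.2.1.1 by fun_prop) hE)
    (Measurable.ite (measurableSet_lt (by fun_prop) h2) (h2.const_div 1) measurable_const)
    measurable_const

/-- Integrating out the Bernoulli draw leaves a factor `1 - 1/(2B)` on `E` and `1` off `E`.
Averaging over `x` gives `1 - p/(2B) ≤ exp(-p/(2B))`, where `p` is the mass of `E`. -/
theorem lintegral_exp_ipw_le {𝒟 : Measure (𝒳 × Bool)} [IsProbabilityMeasure 𝒟] {E : Set 𝒳}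
    (hE : MeasurableSet E) {q : 𝒳 → ℝ} (hq : Measurable q) {B : ℝ} (hB : 1 ≤ B)
    (hqB : ∀ x, 1 / B ≤ q x) (hq1 : ∀ x, q x ≤ 1) :
    ∫⁻ z, ENNReal.ofReal (Real.exp (-(1 / B * ipw E q z)))
        ∂(𝒟.prod (volume.restrict (Set.Icc (0 : ℝ) 1)))
      ≤ ENNReal.ofReal (Real.exp (-(𝒟.fst.real E / (2 * B)))) := by
  classical
  -- A one-point parameter space turns the joint measurability lemma into one for fixed `q`.
  have hm : Measurable (ipw E q) :=
    (measurable_ipw (m := ⊤) (q := fun a : Unit × 𝒳 => q a.2) hE (hq.comp measurable_snd)).comp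
      (measurable_prodMk_left (x := ()))
  have hB2 : 1 / (2 * B) ≤ 1 := by rw [div_le_one (by linarith)]; linarith
  rw [lintegral_prod _ (by fun_prop)]
  calc _ ≤ ∫⁻ z, ENNReal.ofReal (1 - E.indicator (fun _ => 1 / (2 * B)) z.1) ∂𝒟 := by
        refine lintegral_mono fun z => ?_
        by_cases hz : z.1 ∈ E
        · simpa [ipw, hz] using lintegral_exp_bernoulli_le hB (hqB z.1) (hq1 z.1)
        · simp [ipw, hz]
    _ = ∫⁻ x, ENNReal.ofReal (1 - E.indicator (fun _ => 1 / (2 * B)) x) ∂𝒟.fst := by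
        rw [Measure.fst, lintegral_map _ measurable_fst]
        exact (measurable_const.sub (measurable_const.indicator hE)).ennreal_ofReal
    _ = ENNReal.ofReal (1 - 𝒟.fst.real E * (1 / (2 * B))) := by
        have hi : Integrable (E.indicator (fun _ : 𝒳 => 1 / (2 * B))) 𝒟.fst :=
          (integrable_const _).indicator hE
        rw [← ofReal_integral_eq_lintegral_ofReal
          (f := fun x => 1 - E.indicator (fun _ => 1 / (2 * B)) x) ((integrable_const _).sub hi)]
        · rw [integral_sub (integrable_const _) hi, integral_indicator hE]
          simp
        · refine Filter.Eventually.of_forall fun x => ?_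
          by_cases hx : x ∈ E <;> simp [hx]
          simpa using hB2
    _ ≤ _ := by
        apply ENNReal.ofReal_le_ofReal
        refine le_trans (le_of_eq ?_) (Real.one_sub_le_exp_neg _)
        ring

/-- One epoch of the lower tail bound for inverse propensity weighted sums. -/
theorem lintegral_mul_exp_sum_ipw_le {𝒟 : Measure (𝒳 × Bool)} [IsProbabilityMeasure 𝒟]
    {Ω : Type*} [mΩ : MeasurableSpace Ω] {ρ : Measure Ω} [IsProbabilityMeasure ρ]
    {𝓕 : Filtration ℕ mΩ} {ξ : ℕ → Ω → (𝒳 × Bool) × ℝ}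
    (hξ : ∀ i, Measurable[𝓕 (i + 1)] (ξ (i + 1)))
    (hlaw : ∀ i, ρ.map (ξ (i + 1)) = 𝒟.prod (volume.restrict (Set.Icc (0 : ℝ) 1)))
    (hind : ∀ i, Indep (MeasurableSpace.comap (ξ (i + 1)) inferInstance) (𝓕 i) ρ)
    {a : ℕ} {F : Ω → ℝ≥0∞} (hF : Measurable[𝓕 a] F) {q : Ω × 𝒳 → ℝ}
    (hq : Measurable[(𝓕 a).prod inferInstance] q) {E : Set 𝒳} (hE : MeasurableSet E)
    {B : ℝ} (hB : 1 ≤ B) (hqB : ∀ᵐ ω ∂ρ, ∀ x, 1 / B ≤ q (ω, x) ∧ q (ω, x) ≤ 1)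
    {b : ℕ} (hab : a ≤ b) :
    ∫⁻ ω, F ω * ENNReal.ofReal (Real.exp (-(1 / B *
        ∑ i ∈ Finset.Ioc a b, ipw E (fun x => q (ω, x)) (ξ i ω)))) ∂ρ
      ≤ (∫⁻ ω, F ω ∂ρ) *
        ENNReal.ofReal (Real.exp (-((b - a : ℕ) * (𝒟.fst.real E / (2 * B))))) := by
  have hqm : ∀ k, a ≤ k → Measurable[(𝓕 k).prod inferInstance] q := fun k hk =>
    hq.mono (sup_le_sup (MeasurableSpace.comap_mono (𝓕.mono hk)) le_rfl) le_rfl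
  have hWi : ∀ k i, a ≤ k → 1 ≤ i → i ≤ k →
      Measurable[𝓕 k] fun ω => ipw E (fun x => q (ω, x)) (ξ i ω) := by
    intro k i hk h1 hi
    obtain ⟨i, rfl⟩ := Nat.exists_eq_add_of_le' h1
    exact (@measurable_ipw 𝒳 _ Ω (𝓕 k) E hE q (hqm k hk)).comp
      (Measurable.prodMk (@measurable_id _ (𝓕 k)) ((hξ i).mono (𝓕.mono hi) le_rfl))
  induction b, hab using Nat.le_induction with
  | base => simp
  | succ k hk ih =>
    have hG : Measurable[𝓕 k] fun ω => F ω * ENNReal.ofReal (Real.exp (-(1 / B *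
        ∑ i ∈ Finset.Ioc a k, ipw E (fun x => q (ω, x)) (ξ i ω)))) := by
      refine (hF.mono (𝓕.mono hk) le_rfl).mul (Measurable.ennreal_ofReal
        (Real.measurable_exp.comp (Measurable.neg (Measurable.const_mul
          (Finset.measurable_fun_sum _ fun i hi => ?_) _))))
      rw [Finset.mem_Ioc] at hi
      exact hWi k i hk (by omega) hi.2
    set G : Ω → ℝ≥0∞ := fun ω => F ω * ENNReal.ofReal (Real.exp (-(1 / B *
        ∑ i ∈ Finset.Ioc a k, ipw E (fun x => q (ω, x)) (ξ i ω))))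
    have hf : Measurable[(𝓕 k).prod inferInstance] fun p : Ω × ((𝒳 × Bool) × ℝ) =>
        G p.1 * ENNReal.ofReal (Real.exp (-(1 / B * ipw E (fun x => q (p.1, x)) p.2))) :=
      (hG.comp measurable_fst).mul (Measurable.ennreal_ofReal
        (Real.measurable_exp.comp (Measurable.neg (Measurable.const_mul
          (@measurable_ipw 𝒳 _ Ω (𝓕 k) E hE q (hqm k hk)) _))))
    calc _ = ∫⁻ ω, G ω * ENNReal.ofReal (Real.exp (-(1 / B *
            ipw E (fun x => q (ω, x)) (ξ (k + 1) ω)))) ∂ρ := by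
          refine lintegral_congr fun ω => ?_
          rw [Finset.sum_Ioc_succ_top (by omega), mul_add, neg_add, Real.exp_add,
            ENNReal.ofReal_mul (Real.exp_pos _).le, ← mul_assoc]
      _ = ∫⁻ ω, ∫⁻ z, G ω * ENNReal.ofReal (Real.exp (-(1 / B *
            ipw E (fun x => q (ω, x)) z))) ∂(ρ.map (ξ (k + 1))) ∂ρ :=
          lintegral_comp_of_indep (𝓕.le k) ((hξ k).mono (𝓕.le _) le_rfl) (hind k) hf
      _ ≤ ∫⁻ ω, G ω * ENNReal.ofReal (Real.exp (-(𝒟.fst.real E / (2 * B)))) ∂ρ := by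
          -- Once `ω` is frozen, `q (ω, ·)` is a fixed function and the bound for one example
          -- applies.
          refine lintegral_mono_ae (hqB.mono fun ω hω => ?_)
          rw [hlaw]
          have hqω : Measurable fun x => q (ω, x) :=
            hq.comp (@measurable_prodMk_left _ _ (𝓕 a) _ ω)
          have hm : Measurable (ipw E fun x => q (ω, x)) :=
            (@measurable_ipw 𝒳 _ Ω (𝓕 a) E hE q hq).comp
              (@measurable_prodMk_left _ _ (𝓕 a) _ ω)
          rw [lintegral_const_mul _ (by fun_prop)]
          gcongr
          exact lintegral_exp_ipw_le hE hqω hB (fun x => (hω x).1) fun x => (hω x).2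
      _ = (∫⁻ ω, G ω ∂ρ) * ENNReal.ofReal (Real.exp (-(𝒟.fst.real E / (2 * B)))) :=
          lintegral_mul_const _ (hG.mono (𝓕.le k) le_rfl)
      _ ≤ _ := by
          refine (mul_le_mul_left ih _).trans (le_of_eq ?_)
          rw [mul_assoc, ← ENNReal.ofReal_mul (Real.exp_pos _).le, ← Real.exp_add,
            Nat.succ_sub hk]
          congr 3
          push_cast
          ring

end ActiveCover

namespace ActiveCover

noncomputable section

/-! ### The schedule and the constants -/

namespace Params.ValidSchedule

variable {prm : Params}

theorem mono (hs : prm.ValidSchedule) {a b : ℕ} (hab : a ≤ b) (hb : b ≤ prm.M) :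
    prm.τ a ≤ prm.τ b := by
  induction b, hab using Nat.le_induction with
  | base => exact le_rfl
  | succ k _ ih => exact (ih (by omega)).trans (hs.lt_succ k (by omega)).le

theorem three_le (hs : prm.ValidSchedule) {m : ℕ} (h1 : 1 ≤ m) (hm : m ≤ prm.M) :
    3 ≤ prm.τ m :=
  hs.one ▸ hs.mono h1 hm

theorem one_le_log (hs : prm.ValidSchedule) {m : ℕ} (h1 : 1 ≤ m) (hm : m ≤ prm.M) :
    1 ≤ Real.log (prm.τ m) := by
  have h3 : (3 : ℝ) ≤ prm.τ m := by exact_mod_cast hs.three_le h1 hm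
  rw [Real.le_log_iff_exp_le (by linarith)]
  linarith [Real.exp_one_lt_d9]

theorem log_le_log (hs : prm.ValidSchedule) {a b : ℕ} (ha : 1 ≤ a) (hab : a ≤ b)
    (hb : b ≤ prm.M) : Real.log (prm.τ a) ≤ Real.log (prm.τ b) := by
  have h3 := hs.three_le ha (hab.trans hb)
  exact Real.log_le_log (by exact_mod_cast (by omega : 0 < prm.τ a))
    (by exact_mod_cast hs.mono hab hb)

/-- Since the schedule at most doubles, `(b - a)/a ≤ 2 (1 - a/b) ≤ 2 log (b/a)` for consecutive
terms `a < b`, and the logarithms telescope. -/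
theorem sum_ratio_le (hs : prm.ValidSchedule) {k : ℕ} (hk : k + 1 ≤ prm.M) :
    ∑ m ∈ Finset.range k, ((prm.τ (m + 2) - prm.τ (m + 1) : ℕ) : ℝ) / prm.τ (m + 1)
      ≤ 2 * Real.log (prm.τ (k + 1)) := by
  induction k with
  | zero =>
    simp only [Finset.range_zero, Finset.sum_empty]
    linarith [hs.one_le_log le_rfl hk]
  | succ k ih =>
    rw [Finset.sum_range_succ]
    have h3 := hs.three_le (m := k + 1) (by omega) (by omega)
    have hlt := hs.lt_succ (k + 1) (by omega)
    have hle := hs.succ_le (k + 1) (by omega) (by omega)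
    have a0 : (0 : ℝ) < prm.τ (k + 1) := by exact_mod_cast (by omega : 0 < prm.τ (k + 1))
    have b0 : (0 : ℝ) < prm.τ (k + 2) := by exact_mod_cast (by omega : 0 < prm.τ (k + 1 + 1))
    have hle' : (prm.τ (k + 2) : ℝ) ≤ 2 * prm.τ (k + 1) := by exact_mod_cast hle
    have hlt' : (prm.τ (k + 1) : ℝ) < prm.τ (k + 2) := by exact_mod_cast hlt
    have hlog := Real.one_sub_inv_le_log_of_pos (div_pos b0 a0)
    rw [Real.log_div b0.ne' a0.ne', inv_div] at hlog
    have key : ((prm.τ (k + 2) - prm.τ (k + 1) : ℕ) : ℝ) / prm.τ (k + 1)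
        ≤ 2 * (1 - (prm.τ (k + 1) : ℝ) / prm.τ (k + 2)) := by
      rw [Nat.cast_sub hlt.le, one_sub_div b0.ne', mul_div_assoc',
        div_le_div_iff₀ a0 b0]
      nlinarith
    have := ih (by omega)
    linarith

theorem eps_pos (hs : prm.ValidSchedule) {k : ℕ} (hL : 0 < Real.log ((k : ℝ) / prm.δ)) {m : ℕ}
    (h1 : 1 ≤ m) (hm : m ≤ prm.M) : 0 < prm.eps k m := by
  have := hs.one_le_log h1 hm
  have h3 : (3 : ℝ) ≤ prm.τ m := by exact_mod_cast hs.three_le h1 hm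
  unfold eps
  exact div_pos (by linarith) (by linarith)

end Params.ValidSchedule

namespace Params.ValidConstants

variable {prm : Params} {k : ℕ}

theorem one_le_gamma (hc : prm.ValidConstants k) : 1 ≤ prm.γ := by
  linarith [hc.gamma, hc.eta]

theorem one_le_c₂ (hc : prm.ValidConstants k) : 1 ≤ prm.c₂ := by
  have h6 : 1 ≤ Real.sqrt 6 := Real.one_le_sqrt.2 (by norm_num)
  have h1 : 1 ≤ prm.c₁ := by nlinarith [hc.c₁, hc.alpha]
  nlinarith [hc.c₂, hc.eta]

end Params.ValidConstants

section Sample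

variable {𝒳 : Type*} {prm : Params} {H : Finset (𝒳 → Bool)}

/-- An unqueried example still enters the sample, with weight zero, so the denominator of `empErr`
is deterministic. -/
theorem card_sample (hsched : prm.ValidSchedule) (π : Path 𝒳) {m : ℕ} (hm : m ≤ prm.M) :
    Multiset.card (sample prm H π m) = prm.τ m := by
  induction m with
  | zero => simp [sample, hsched.zero]
  | succ m ih =>
    have := hsched.lt_succ m hm
    simp only [sample, Multiset.card_add, Multiset.card_map, ih (by omega), Finset.card_val,
      Nat.card_Ioc]
    omega

/-- The numerator of `empErr`. -/
def weightedSum (h : 𝒳 → Bool) (S : Multiset (𝒳 × Bool × ℝ)) : ℝ :=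
  (S.map fun e => if h e.1 ≠ e.2.1 then e.2.2 else 0).sum

theorem empErr_sample (hsched : prm.ValidSchedule) (π : Path 𝒳) {m : ℕ} (hm : m ≤ prm.M)
    (h : 𝒳 → Bool) :
    empErr h (sample prm H π m) = weightedSum h (sample prm H π m) / prm.τ m := by
  rw [empErr, card_sample hsched π hm, weightedSum]

end Sample

/-! ### The realizable process

In the realizable case almost every execution treats example `i` of epoch `m + 1` as if its
label were known with the probability `samplingProb`, so that the empirical errors are inverse
propensity weighted frequencies of the events `{h ≠ hstar}`. -/

section Realizable

variable {𝒳 : Type*} [MeasurableSpace 𝒳] {prm : Params} {H : Finset (𝒳 → Bool)}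
  {𝒟 : Measure (𝒳 × Bool)} {Ω : Type*} [mΩ : MeasurableSpace Ω] {ρ : Measure Ω}

/-- The value of `γ Δ_m` in the realizable case. -/
def radius (prm : Params) (k m : ℕ) : ℝ :=
  prm.γ * (prm.c₂ * prm.eps k m * Real.log (prm.τ m))

/-- The classifiers whose weighted number of mistakes `S h` is small after epoch `m`. -/
def survivors (prm : Params) (H : Finset (𝒳 → Bool)) (m : ℕ) (S : (𝒳 → Bool) → ℝ) :
    Set (𝒳 → Bool) :=
  {h | h ∈ H ∧ S h / prm.τ m ≤ radius prm H.card m}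

namespace Run

/-- The `i`-th example together with the number that realizes its Bernoulli draw. -/
def drawnExample (R : Run prm H 𝒟 ρ) (i : ℕ) (ω : Ω) : (𝒳 × Bool) × ℝ := ((R.X i ω, R.Y i ω), R.U i ω)

open Classical in
/-- The probability with which the correct label of an example of epoch `m + 1` becomes known, in
terms of the weighted numbers of mistakes `S` after epoch `m`. -/
def samplingProb (R : Run prm H 𝒟 ρ) (m : ℕ) (S : (𝒳 → Bool) → ℝ) (ω : Ω) (x : 𝒳) : ℝ :=
  -- The value `1` covers epoch 1, where every label is queried, and the points where all survivors
  -- agree, where the inferred label is correct.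
  if m ≠ 0 ∧ x ∈ DIS (survivors prm H m S) then R.P (m + 1) ω x else 1

/-- The importance weighted number of mistakes of `h` on the sample after epoch `m`. -/
def mistakes (R : Run prm H 𝒟 ρ) (hstar : 𝒳 → Bool) : ℕ → Ω → (𝒳 → Bool) → ℝ
  | 0 => fun _ _ => 0
  | m + 1 => fun ω h => mistakes R hstar m ω h +
      ∑ i ∈ Finset.Ioc (prm.τ m) (prm.τ (m + 1)),
        ipw {x | h x ≠ hstar x} (R.samplingProb m (mistakes R hstar m ω) ω) (R.drawnExample i ω)

variable {R : Run prm H 𝒟 ρ} {hstar : 𝒳 → Bool}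

theorem measurable_samplingProb (hmeas : ∀ h ∈ H, Measurable h) {m : ℕ} (hm : m < prm.M)
    {S : Ω → (𝒳 → Bool) → ℝ} (hS : ∀ h ∈ H, Measurable[R.𝓕 (prm.τ m)] fun ω => S ω h) :
    Measurable[(R.𝓕 (prm.τ m)).prod inferInstance]
      fun a : Ω × 𝒳 => R.samplingProb m (S a.1) a.1 a.2 := by
  classical
  rcases Nat.eq_zero_or_pos m with rfl | h0
  · simp only [samplingProb, ne_eq, not_true_eq_false, false_and, if_false]
    exact measurable_const
  · simp only [samplingProb, ne_eq, h0.ne', not_false_eq_true, true_and]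
    refine Measurable.ite ?_ (R.measurable_P m h0 hm) measurable_const
    -- As `H` is finite, the random region is a finite union of rectangles, each an event about the
    -- past times a set `{h ≠ h'}`.
    have hset : {a : Ω × 𝒳 | a.2 ∈ DIS (survivors prm H m (S a.1))} =
        ⋃ h ∈ H, ⋃ h' ∈ H, ({ω | S ω h / prm.τ m ≤ radius prm H.card m} ∩
          {ω | S ω h' / prm.τ m ≤ radius prm H.card m}) ×ˢ {x | h x ≠ h' x} := by
      ext a
      simp only [DIS, survivors, Set.mem_ofPred_eq, Set.mem_iUnion, Set.mem_prod, Set.mem_inter_iff]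
      constructor
      · rintro ⟨h, ⟨hh, h1⟩, h', ⟨hh', h2⟩, hx⟩
        exact ⟨h, hh, h', hh', ⟨h1, h2⟩, hx⟩
      · rintro ⟨h, hh, h', hh', ⟨h1, h2⟩, hx⟩
        exact ⟨h, ⟨hh, h1⟩, h', ⟨hh', h2⟩, hx⟩
    rw [hset]
    have hle : ∀ h ∈ H, MeasurableSet[R.𝓕 (prm.τ m)]
        {ω | S ω h / prm.τ m ≤ radius prm H.card m} := fun h hh =>
      ((hS h hh).div_const _) measurableSet_Iic
    exact Finset.measurableSet_biUnion _ fun h hh => Finset.measurableSet_biUnion _ fun h' hh' =>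
      @MeasurableSet.prod _ _ (R.𝓕 (prm.τ m)) _ _ _
        (@MeasurableSet.inter _ (R.𝓕 (prm.τ m)) _ _ (hle h hh) (hle h' hh'))
        (measurableSet_eq_fun (hmeas h hh) (hmeas h' hh')).compl

theorem measurable_mistakes (hsched : prm.ValidSchedule) (hmeas : ∀ h ∈ H, Measurable h)
    (hstar_mem : hstar ∈ H) {m : ℕ} (hm : m ≤ prm.M) {h : 𝒳 → Bool} (hh : h ∈ H) :
    Measurable[R.𝓕 (prm.τ m)] fun ω => R.mistakes hstar m ω h := by
  induction m generalizing h with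
  | zero => exact measurable_const
  | succ m ih =>
    have hlt := hsched.lt_succ m hm
    have hq := measurable_samplingProb (R := R) hmeas hm fun h hh => ih (by omega) hh
    have hq' : Measurable[(R.𝓕 (prm.τ (m + 1))).prod inferInstance]
        fun a : Ω × 𝒳 => R.samplingProb m (R.mistakes hstar m a.1) a.1 a.2 :=
      hq.mono (sup_le_sup (MeasurableSpace.comap_mono (R.𝓕.mono hlt.le)) le_rfl) le_rfl
    simp only [mistakes]
    refine ((ih (by omega) hh).mono (R.𝓕.mono hlt.le) le_rfl).add
      (Finset.measurable_fun_sum _ fun i hi => ?_)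
    rw [Finset.mem_Ioc] at hi
    obtain ⟨i, rfl⟩ := Nat.exists_eq_add_of_le' (show 1 ≤ i by omega)
    exact (@measurable_ipw 𝒳 _ Ω (R.𝓕 (prm.τ (m + 1))) _
      (measurableSet_eq_fun (hmeas h hh) (hmeas hstar hstar_mem)).compl _ hq').comp
      (Measurable.prodMk (@measurable_id _ (R.𝓕 (prm.τ (m + 1))))
        ((R.measurable_example i).mono (R.𝓕.mono hi.2) le_rfl))

/-- The event of probability one on which all labels are those of `hstar`. -/
def Realized (R : Run prm H 𝒟 ρ) (hstar : 𝒳 → Bool) (ω : Ω) : Prop :=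
  ∀ i, R.Y (i + 1) ω = hstar (R.X (i + 1) ω) ∧ R.U (i + 1) ω < 1

theorem ae_realized [IsProbabilityMeasure 𝒟] (hreal : trueErr 𝒟 hstar = 0) : ∀ᵐ ω ∂ρ, R.Realized hstar ω := by
  refine ae_all_iff.2 fun i => ?_
  have hξ := (R.measurable_example i).mono (R.𝓕.le _) le_rfl
  have key : ∀ᵐ z ∂(𝒟.prod (volume.restrict (Set.Icc (0 : ℝ) 1))),
      z.1.2 = hstar z.1.1 ∧ z.2 < 1 := by
    have h1 : ∀ᵐ z ∂𝒟, z.2 = hstar z.1 := by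
      rw [ae_iff]
      have := (measureReal_eq_zero_iff (μ := 𝒟)).1 hreal
      simpa only [eq_comm, ne_eq] using this
    -- Strictness makes a draw with success probability `1` always succeed in `ipw`.
    have h2 : ∀ᵐ u ∂(volume.restrict (Set.Icc (0 : ℝ) 1)), u < 1 := by
      rw [← Measure.restrict_congr_set Ico_ae_eq_Icc]
      exact (ae_restrict_mem measurableSet_Ico).mono fun u hu => hu.2
    exact (Measure.quasiMeasurePreserving_fst.ae h1).and
      (Measure.quasiMeasurePreserving_snd.ae h2)
  rw [← R.law_example i] at key
  exact ae_of_ae_map hξ.aemeasurable key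

theorem mistakes_hstar (m : ℕ) (ω : Ω) : R.mistakes hstar m ω hstar = 0 := by
  induction m with
  | zero => rfl
  | succ m ih => simp [mistakes, ih, ipw]

/-- The competitor `hstar` has weighted error zero, and no weighted error is negative. -/
theorem empErr_erm_eq_zero (hsched : prm.ValidSchedule) (hstar_mem : hstar ∈ H) {m : ℕ}
    (h1 : 1 ≤ m) (hm : m < prm.M) {ω : Ω}
    (hS : ∀ h ∈ H, weightedSum h (sample prm H (R.path ω) m) = R.mistakes hstar m ω h)
    (hnn : ∀ h ∈ H, 0 ≤ R.mistakes hstar m ω h) :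
    empErr ((R.path ω).h (m + 1)) (sample prm H (R.path ω) m) = 0 := by
  obtain ⟨hmem, hmin⟩ : IsERMSucc prm H (R.path ω) m := R.erm m h1 hm ω
  refine le_antisymm ((hmin hstar hstar_mem).trans (le_of_eq ?_)) ?_
  · rw [empErr_sample hsched _ hm.le, hS _ hstar_mem, mistakes_hstar, zero_div]
  · rw [empErr_sample hsched _ hm.le, hS _ hmem]
    exact div_nonneg (hnn _ hmem) (Nat.cast_nonneg _)

/-- A vanishing minimal error kills the square-root term of the threshold, which makes the
acceptance level deterministic. -/
theorem goodSet_eq_survivors (hsched : prm.ValidSchedule) (hstar_mem : hstar ∈ H) {m : ℕ}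
    (h1 : 1 ≤ m) (hm : m < prm.M) {ω : Ω}
    (hS : ∀ h ∈ H, weightedSum h (sample prm H (R.path ω) m) = R.mistakes hstar m ω h)
    (hnn : ∀ h ∈ H, 0 ≤ R.mistakes hstar m ω h) :
    goodSet prm H m (sample prm H (R.path ω) m) ((R.path ω).h (m + 1))
      = survivors prm H m (R.mistakes hstar m ω) := by
  ext h
  simp only [goodSet, survivors, Set.mem_ofPred_eq, threshold, radius,
    empErr_erm_eq_zero hsched hstar_mem h1 hm hS hnn, mul_zero, Real.sqrt_zero, zero_add, sub_zero,
    if_neg (show m ≠ 0 by omega)]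
  refine and_congr_right fun hh => ?_
  rw [empErr_sample hsched _ hm.le, hS h hh]

theorem samplingProb_nonneg {m : ℕ} (hm : m < prm.M) (S : (𝒳 → Bool) → ℝ) (ω : Ω) (x : 𝒳) :
    0 ≤ R.samplingProb m S ω x := by
  unfold samplingProb
  split_ifs with h
  · exact (((R.solves m (Nat.one_le_iff_ne_zero.2 h.1) hm ω).1.mem_unit) x).1
  · exact zero_le_one

theorem samplingProb_le_one {m : ℕ} (hm : m < prm.M) (S : (𝒳 → Bool) → ℝ) (ω : Ω) (x : 𝒳) :
    R.samplingProb m S ω x ≤ 1 := by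
  unfold samplingProb
  split_ifs with h
  · exact (((R.solves m (Nat.one_le_iff_ne_zero.2 h.1) hm ω).1.mem_unit) x).2
  · exact le_rfl

theorem mistakes_nonneg {m : ℕ} (hm : m ≤ prm.M) (ω : Ω) (h : 𝒳 → Bool) :
    0 ≤ R.mistakes hstar m ω h := by
  induction m with
  | zero => exact le_rfl
  | succ m ih =>
    refine add_nonneg (ih (by omega)) (Finset.sum_nonneg fun i _ => ?_)
    refine Set.indicator_nonneg (fun x _ => ?_) _
    split_ifs
    · exact one_div_nonneg.2 (samplingProb_nonneg (by omega) _ _ _)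
    · exact le_rfl

theorem hstar_mem_survivors (hc : 0 ≤ radius prm H.card m) (hstar_mem : hstar ∈ H) (ω : Ω) :
    hstar ∈ survivors prm H m (R.mistakes hstar m ω) := by
  refine ⟨hstar_mem, ?_⟩
  rw [mistakes_hstar, zero_div]
  exact hc

/-- In the realizable case the empirical errors are the weighted numbers of mistakes. -/
theorem weightedSum_sample (hsched : prm.ValidSchedule) (hstar_mem : hstar ∈ H)
    (hr : ∀ m, 1 ≤ m → m < prm.M → 0 ≤ radius prm H.card m) {ω : Ω}
    (hω : R.Realized hstar ω) {m : ℕ} (hm : m ≤ prm.M) {h : 𝒳 → Bool} (hh : h ∈ H) :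
    weightedSum h (sample prm H (R.path ω) m) = R.mistakes hstar m ω h := by
  induction m generalizing h with
  | zero => simp [weightedSum, sample, mistakes]
  | succ m ih =>
    have hstep : weightedSum h (sample prm H (R.path ω) (m + 1)) =
        weightedSum h (sample prm H (R.path ω) m) +
        ∑ i ∈ Finset.Ioc (prm.τ m) (prm.τ (m + 1)), weightedSum h {weightedExample (R.path ω) (m + 1)
          (DIS (goodSet prm H m (sample prm H (R.path ω) m) ((R.path ω).h (m + 1)))) i} := by
      simp only [weightedSum, sample, Multiset.map_add, Multiset.sum_add, Multiset.map_map,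
        Multiset.map_singleton, Multiset.sum_singleton]
      rfl
    rw [hstep, ih (by omega) hh, mistakes]
    congr 1
    refine Finset.sum_congr rfl fun i hi => ?_
    rw [Finset.mem_Ioc] at hi
    obtain ⟨i, rfl⟩ := Nat.exists_eq_add_of_le' (show 1 ≤ i by omega)
    obtain ⟨hy, hu⟩ := hω i
    have hpx : (R.path ω).x (i + 1) = R.X (i + 1) ω := rfl
    have hpy : (R.path ω).y (i + 1) = hstar (R.X (i + 1) ω) := hy
    have hpu : (R.path ω).u (i + 1) = R.U (i + 1) ω := rfl
    have hpP : (R.path ω).P (m + 1) = R.P (m + 1) ω := rfl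
    simp only [weightedSum, Multiset.map_singleton, Multiset.sum_singleton, ipw, drawnExample]
    rcases Nat.eq_zero_or_pos m with rfl | h0
    · simp [weightedExample, samplingProb, hu, hpx, hpy, Set.indicator_apply]
    · have hg := goodSet_eq_survivors (R := R) hsched hstar_mem h0 hm
        (fun h hh => ih (by omega) hh) fun h _ => mistakes_nonneg (by omega) ω h
      -- The minimizer has empirical error zero, hence survives.
      have hmem : (R.path ω).h (m + 1) ∈ survivors prm H m (R.mistakes hstar m ω) := by
        have hH : (R.path ω).h (m + 1) ∈ H := (R.erm m h0 hm ω).1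
        refine ⟨hH, ?_⟩
        have h2 := empErr_erm_eq_zero (R := R) hsched hstar_mem h0 hm
          (fun h hh => ih (by omega) hh) fun h _ => mistakes_nonneg (by omega) ω h
        rw [empErr_sample hsched _ (by omega), ih (by omega) hH] at h2
        rw [h2]
        exact hr m h0 hm
      rw [hg]
      by_cases hD : R.X (i + 1) ω ∈ DIS (survivors prm H m (R.mistakes hstar m ω))
      · by_cases hq : R.U (i + 1) ω < R.P (m + 1) ω (R.X (i + 1) ω) <;>
          simp [weightedExample, samplingProb, Queried, h0.ne', hD, hq, hpx, hpy, hpu, hpP,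
            Set.indicator_apply]
      -- Both classifiers survive, so they agree outside the disagreement region and the inferred
      -- label is correct.
      · have hag : (R.path ω).h (m + 1) (R.X (i + 1) ω) = hstar (R.X (i + 1) ω) := by
          by_contra hne
          exact hD ⟨_, hmem, _, hstar_mem_survivors (hr m h0 hm) hstar_mem ω, hne⟩
        simp [weightedExample, samplingProb, h0.ne', hD, hpx, hu, hag, Set.indicator_apply]

theorem regionSucc_eq (hsched : prm.ValidSchedule) (hstar_mem : hstar ∈ H)
    (hr : ∀ m, 1 ≤ m → m < prm.M → 0 ≤ radius prm H.card m) {ω : Ω}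
    (hω : R.Realized hstar ω) {m : ℕ} (h1 : 1 ≤ m) (hm : m < prm.M) :
    regionSucc prm H (R.path ω) m = DIS (survivors prm H m (R.mistakes hstar m ω)) := by
  rw [regionSucc, goodSet_eq_survivors hsched hstar_mem h1 hm
    (fun h hh => weightedSum_sample hsched hstar_mem hr hω hm.le hh)
    fun h _ => mistakes_nonneg hm.le ω h]

/-- With empirical minimum zero, `P_min` is `min (c₃ / log τ_m) (1/2)`, and both terms are at least
`1 / (2 log τ_m)`. Leaving `B` free lets one value serve all epochs up to a later one. -/
theorem le_samplingProb (hsched : prm.ValidSchedule) (hstar_mem : hstar ∈ H)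
    (hr : ∀ m, 1 ≤ m → m < prm.M → 0 ≤ radius prm H.card m) (hc₃ : 1 ≤ prm.c₃) {ω : Ω}
    (hω : R.Realized hstar ω) {m : ℕ} (hm : m < prm.M) {B : ℝ} (hB : 1 ≤ B)
    (hmB : 1 ≤ m → 2 * Real.log (prm.τ m) ≤ B) (x : 𝒳) :
    1 / B ≤ R.samplingProb m (R.mistakes hstar m ω) ω x := by
  unfold samplingProb
  split_ifs with h
  · have h1 : 1 ≤ m := Nat.one_le_iff_ne_zero.2 h.1
    have hD := h.2
    rw [← regionSucc_eq hsched hstar_mem hr hω h1 hm] at hD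
    refine le_trans ?_ ((R.solves m h1 hm ω).1.pMin_le x hD)
    change _ ≤ pMinSucc prm H (R.path ω) m
    have hlog := hsched.one_le_log h1 hm.le
    have hmB := hmB h1
    rw [pMinSucc, empErr_erm_eq_zero hsched hstar_mem h1 hm
      (fun h hh => weightedSum_sample hsched hstar_mem hr hω hm.le hh)
      fun h _ => mistakes_nonneg hm.le ω h, mul_zero, zero_div, Real.sqrt_zero, zero_add]
    refine le_min ?_ ?_
    · exact div_le_div₀ (by linarith) hc₃ (by linarith) (by linarith)
    · exact one_div_le_one_div_of_le (by norm_num) (by linarith)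
  · rw [div_le_one (by linarith)]
    exact hB

end Run

end Realizable

/-! ### The disagreement coefficient and balls about `hstar`. -/

section Disagreement

variable {𝒳 : Type*} [MeasurableSpace 𝒳] {μ : Measure 𝒳} {H : Finset (𝒳 → Bool)}
  {hstar : 𝒳 → Bool}

/-- The disagreement region of the ball of radius `r` about `hstar`. -/
def ballRegion (μ : Measure 𝒳) (H : Finset (𝒳 → Bool)) (hstar : 𝒳 → Bool) (r : ℝ) : Set 𝒳 :=
  {x | ∃ h ∈ H, hstar x ≠ h x ∧ μ {x' | h x' ≠ hstar x'} ≤ ENNReal.ofReal r}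

theorem measure_ballRegion_le {r : ℝ} (hr : 0 < r) :
    μ (ballRegion μ H hstar r) ≤ disagreementCoeff μ H hstar * ENNReal.ofReal r := by
  rw [← ENNReal.div_le_iff (ENNReal.ofReal_pos.2 hr).ne' ENNReal.ofReal_ne_top]
  exact le_iSup₂ (f := fun (r : ℝ) (_ : 0 < r) =>
    μ (ballRegion μ H hstar r) / ENNReal.ofReal r) r hr

theorem measurableSet_ballRegion (hmeas : ∀ h ∈ H, Measurable h) (hstar_mem : hstar ∈ H) (r : ℝ) :
    MeasurableSet (ballRegion μ H hstar r) := by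
  have : ballRegion μ H hstar r = ⋃ h ∈ H, {x | hstar x ≠ h x} ∩
      {_x : 𝒳 | μ {x' | h x' ≠ hstar x'} ≤ ENNReal.ofReal r} := by
    ext x
    simp only [ballRegion, Set.mem_ofPred_eq, Set.mem_iUnion, Set.mem_inter_iff, exists_prop]
  rw [this]
  exact Finset.measurableSet_biUnion _ fun h hh =>
    (measurableSet_eq_fun (hmeas hstar hstar_mem) (hmeas h hh)).compl.inter (MeasurableSet.const _)

/-- Take `r` to be the mass of `{h ≠ hstar}`: the region of the ball of radius `r` contains this
set. -/
theorem one_le_disagreementCoeff [IsFiniteMeasure μ] {h : 𝒳 → Bool} (hh : h ∈ H)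
    (hp : 0 < μ.real {x | h x ≠ hstar x}) : 1 ≤ disagreementCoeff μ H hstar := by
  have hle := measure_ballRegion_le (μ := μ) (H := H) (hstar := hstar) hp
  rw [ofReal_measureReal] at hle
  have h0 : μ {x | h x ≠ hstar x} ≠ 0 := fun h0 => by simp [Measure.real, h0] at hp
  have hsub : μ {x | h x ≠ hstar x} ≤
      μ (ballRegion μ H hstar (μ.real {x | h x ≠ hstar x})) := by
    refine measure_mono fun x hx => ⟨h, hh, Ne.symm hx, ?_⟩
    rw [ofReal_measureReal]
  refine (ENNReal.mul_le_mul_iff_left h0 (measure_ne_top _ _)).1 ?_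
  rw [one_mul]
  exact hsub.trans hle

end Disagreement

theorem radius_pos {prm : Params} {k : ℕ} (hsched : prm.ValidSchedule)
    (hconst : prm.ValidConstants k) (hL : 0 < Real.log ((k : ℝ) / prm.δ)) {m : ℕ} (h1 : 1 ≤ m)
    (hm : m ≤ prm.M) : 0 < radius prm k m := by
  have := hconst.one_le_gamma
  have := hconst.one_le_c₂
  have := hsched.eps_pos hL h1 hm
  have := hsched.one_le_log h1 hm
  unfold radius
  positivity

theorem radius_le {prm : Params} {k : ℕ} (hsched : prm.ValidSchedule)
    (hconst : prm.ValidConstants k) (hL : 0 < Real.log ((k : ℝ) / prm.δ)) {m : ℕ} (h1 : 1 ≤ m)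
    (hm : m ≤ prm.M) :
    1 / prm.τ m + 4 * radius prm k m ≤ 129 * (prm.γ * prm.c₂) *
      ((Real.log ((k : ℝ) / prm.δ) + Real.log prm.n) * Real.log prm.n) / prm.τ m := by
  have hτ : (0 : ℝ) < prm.τ m := by exact_mod_cast (by have := hsched.three_le h1 hm; omega)
  have hγ := hconst.one_le_gamma
  have hc := hconst.one_le_c₂
  have hgc : 1 ≤ prm.γ * prm.c₂ := by nlinarith
  have hlog := hsched.one_le_log h1 hm
  have hle : Real.log (prm.τ m) ≤ Real.log prm.n := hsched.log_le_log h1 hm le_rfl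
  set L := Real.log ((k : ℝ) / prm.δ)
  set l := Real.log (prm.τ m)
  set N := Real.log prm.n
  have h2 : (L + l) * l ≤ (L + N) * N :=
    mul_le_mul (by linarith) hle (by linarith) (by linarith)
  have h3 : 1 ≤ (L + N) * N := by nlinarith
  have h4 : 1 ≤ prm.γ * prm.c₂ * ((L + N) * N) := by nlinarith
  -- The factor `128` is `4 · 32`, with `32` from `ε_m`. Absorbing the leading `1` makes it `129`.
  have e : 1 / prm.τ m + 4 * radius prm k m
      = (1 + 128 * (prm.γ * prm.c₂) * ((L + l) * l)) / prm.τ m := by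
    rw [radius, Params.eps]
    ring
  rw [e]
  refine div_le_div_of_nonneg_right ?_ hτ.le
  have := mul_le_mul_of_nonneg_left h2 (by linarith : 0 ≤ 128 * (prm.γ * prm.c₂))
  linarith

/-! ### Failure probabilities and the expected number of queries. -/

namespace Run

variable {𝒳 : Type*} [MeasurableSpace 𝒳] {prm : Params} {H : Finset (𝒳 → Bool)}
  {𝒟 : Measure (𝒳 × Bool)} {Ω : Type*} [mΩ : MeasurableSpace Ω] {ρ : Measure Ω}
  {R : Run prm H 𝒟 ρ} {hstar : 𝒳 → Bool}

/-- The event that a classifier of large error survives epoch `m`. -/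
def Overlooked (R : Run prm H 𝒟 ρ) (hstar : 𝒳 → Bool) (m : ℕ) : Set Ω :=
  {ω | ∃ h ∈ survivors prm H m (R.mistakes hstar m ω),
    4 * radius prm H.card m < 𝒟.fst.real {x | h x ≠ hstar x}}

theorem measurableSet_overlooked (hsched : prm.ValidSchedule) (hmeas : ∀ h ∈ H, Measurable h)
    (hstar_mem : hstar ∈ H) {m : ℕ} (hm : m ≤ prm.M) :
    MeasurableSet (R.Overlooked hstar m) := by
  have : R.Overlooked hstar m = ⋃ h ∈ H,
      {ω | R.mistakes hstar m ω h / prm.τ m ≤ radius prm H.card m} ∩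
      {_ω : Ω | 4 * radius prm H.card m < 𝒟.fst.real {x | h x ≠ hstar x}} := by
    ext ω
    simp only [Overlooked, survivors, Set.mem_ofPred_eq, Set.mem_iUnion, Set.mem_inter_iff,
      exists_prop, and_assoc]
  rw [this]
  exact Finset.measurableSet_biUnion _ fun h hh => (measurableSet_le
    (((measurable_mistakes hsched hmeas hstar_mem hm hh).mono (R.𝓕.le _) le_rfl).div_const _)
    measurable_const).inter (MeasurableSet.const _)

/-- The label of an example is queried only in the region of a small ball about `hstar`, unless a
classifier of large error has been overlooked. -/
theorem mem_of_queried [IsFiniteMeasure 𝒟] (hsched : prm.ValidSchedule) (hstar_mem : hstar ∈ H)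
    (hr : ∀ m, 1 ≤ m → m < prm.M → 0 ≤ radius prm H.card m) {ω : Ω}
    (hω : R.Realized hstar ω) {m i : ℕ} (h1 : 1 ≤ m) (hm : m < prm.M)
    (hq : Queried (R.path ω) (m + 1) (regionSucc prm H (R.path ω) m) i) :
    ω ∈ R.Overlooked hstar m ∨
      R.X i ω ∈ ballRegion 𝒟.fst H hstar (4 * radius prm H.card m) := by
  rcases hq with hq | ⟨hx, -⟩
  · omega
  rw [regionSucc_eq hsched hstar_mem hr hω h1 hm] at hx
  have key : ∀ h ∈ survivors prm H m (R.mistakes hstar m ω), hstar (R.X i ω) ≠ h (R.X i ω) →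
      ω ∈ R.Overlooked hstar m ∨
        R.X i ω ∈ ballRegion 𝒟.fst H hstar (4 * radius prm H.card m) := by
    intro h hh hne
    by_cases hp : 4 * radius prm H.card m < 𝒟.fst.real {x | h x ≠ hstar x}
    · exact Or.inl ⟨h, hh, hp⟩
    · refine Or.inr ⟨h, hh.1, hne, ?_⟩
      rw [← ofReal_measureReal]
      exact ENNReal.ofReal_le_ofReal (not_lt.1 hp)
  obtain ⟨h, hh, h', hh', hne⟩ := hx
  -- If two survivors disagree at a point, at least one of them differs from `hstar` there.
  by_cases heq : hstar (R.X i ω) = h (R.X i ω)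
  · exact key h' hh' fun h2 => hne (heq.symm.trans h2)
  · exact key h hh heq

variable [IsProbabilityMeasure 𝒟] [IsProbabilityMeasure ρ]

/-- The scale `2 log τ_m` belongs to the final epoch `m` and stays fixed while `k` runs up to `m`.
It is admissible in every earlier epoch because `log τ_k` increases with `k`. -/
theorem lintegral_exp_mistakes_le (hsched : prm.ValidSchedule) (hmeas : ∀ h ∈ H, Measurable h)
    (hstar_mem : hstar ∈ H) (hreal : trueErr 𝒟 hstar = 0)
    (hr : ∀ m, 1 ≤ m → m < prm.M → 0 ≤ radius prm H.card m) (hc₃ : 1 ≤ prm.c₃) {m : ℕ}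
    (h1 : 1 ≤ m) (hm : m ≤ prm.M) {k : ℕ} (hk : k ≤ m) {h : 𝒳 → Bool} (hh : h ∈ H) :
    ∫⁻ ω, ENNReal.ofReal (Real.exp (-(1 / (2 * Real.log (prm.τ m)) * R.mistakes hstar k ω h))) ∂ρ
      ≤ ENNReal.ofReal (Real.exp (-(prm.τ k *
          (𝒟.fst.real {x | h x ≠ hstar x} / (2 * (2 * Real.log (prm.τ m))))))) := by
  have hlog := hsched.one_le_log h1 hm
  induction k with
  | zero => simp [mistakes, hsched.zero]
  | succ k ih =>
    have hlt := hsched.lt_succ k (by omega)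
    have hmk : Measurable[R.𝓕 (prm.τ k)] fun ω => ENNReal.ofReal (Real.exp
        (-(1 / (2 * Real.log (prm.τ m)) * R.mistakes hstar k ω h))) :=
      Measurable.ennreal_ofReal (Real.measurable_exp.comp (Measurable.neg (Measurable.const_mul
        (measurable_mistakes hsched hmeas hstar_mem (by omega) hh) _)))
    have hstep := lintegral_mul_exp_sum_ipw_le (ξ := R.drawnExample) (𝓕 := R.𝓕)
      R.measurable_example R.law_example R.indep_example hmk
      (measurable_samplingProb (R := R) hmeas (show k < prm.M by omega)
        fun h hh => measurable_mistakes hsched hmeas hstar_mem (by omega) hh)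
      (E := {x | h x ≠ hstar x}) (measurableSet_eq_fun (hmeas h hh) (hmeas hstar hstar_mem)).compl
      (B := 2 * Real.log (prm.τ m)) (by linarith)
      ((ae_realized (R := R) hreal).mono fun ω hω x =>
        ⟨le_samplingProb hsched hstar_mem hr hc₃ hω (by omega) (by linarith)
          (fun hk1 => by
            have := hsched.log_le_log hk1 (show k ≤ m by omega) hm
            linarith) x,
          samplingProb_le_one (by omega) _ _ _⟩) hlt.le
    calc _ = _ := by
          refine lintegral_congr fun ω => ?_
          rw [mistakes, mul_add, neg_add, Real.exp_add, ENNReal.ofReal_mul (Real.exp_pos _).le]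
      _ ≤ _ := hstep
      _ ≤ _ := by
          refine (mul_le_mul_left (ih (by omega)) _).trans (le_of_eq ?_)
          rw [← ENNReal.ofReal_mul (Real.exp_pos _).le, ← Real.exp_add, Nat.cast_sub hlt.le]
          congr 2
          ring

/-- A single classifier of large error survives with small probability. -/
theorem measure_survives_le (hsched : prm.ValidSchedule) (hconst : prm.ValidConstants H.card)
    (hmeas : ∀ h ∈ H, Measurable h) (hstar_mem : hstar ∈ H) (hreal : trueErr 𝒟 hstar = 0)
    (hδ : 0 < prm.δ) (hL : 0 < Real.log ((H.card : ℝ) / prm.δ)) {m : ℕ} (h1 : 1 ≤ m)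
    (hm : m ≤ prm.M) {h : 𝒳 → Bool} (hh : h ∈ H)
    (hp : 4 * radius prm H.card m < 𝒟.fst.real {x | h x ≠ hstar x}) :
    ρ {ω | R.mistakes hstar m ω h / prm.τ m ≤ radius prm H.card m}
      ≤ ENNReal.ofReal (prm.δ / H.card / prm.τ m) := by
  have hlog := hsched.one_le_log h1 hm
  have hτ : (0 : ℝ) < prm.τ m := by exact_mod_cast (by have := hsched.three_le h1 hm; omega)
  have hγ := hconst.one_le_gamma
  have hc := hconst.one_le_c₂
  have hH : (0 : ℝ) < H.card := by exact_mod_cast Finset.card_pos.2 ⟨hstar, hstar_mem⟩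
  have hlin := lintegral_exp_mistakes_le (R := R) hsched hmeas hstar_mem hreal
    (fun m h1 hm => (radius_pos hsched hconst hL h1 hm.le).le) hconst.c₃ h1 hm le_rfl hh
  set r := radius prm H.card m with hr
  set B := 2 * Real.log (prm.τ m) with hBdef
  have hB : 0 < B := by linarith
  set e := ENNReal.ofReal (Real.exp (-(1 / B * (r * prm.τ m)))) with he
  -- Survival forces the exponential moment variable to be at least `e`, so Markov's inequality
  -- applies.
  have hsub : {ω | R.mistakes hstar m ω h / prm.τ m ≤ r} ⊆
      {ω | e ≤ ENNReal.ofReal (Real.exp (-(1 / B * R.mistakes hstar m ω h)))} := by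
    intro ω hω
    have hω : R.mistakes hstar m ω h / prm.τ m ≤ r := hω
    rw [div_le_iff₀ hτ] at hω
    apply ENNReal.ofReal_le_ofReal
    gcongr
  have hmk : Measurable fun ω => ENNReal.ofReal (Real.exp (-(1 / B * R.mistakes hstar m ω h))) :=
    Measurable.ennreal_ofReal (Real.measurable_exp.comp (Measurable.neg (Measurable.const_mul
      ((measurable_mistakes hsched hmeas hstar_mem hm hh).mono (R.𝓕.le _) le_rfl) _)))
  have hepos : e ≠ 0 := (ENNReal.ofReal_pos.2 (Real.exp_pos _)).ne'
  refine (measure_mono hsub).trans ((meas_ge_le_lintegral_div hmk.aemeasurable hepos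
    ENNReal.ofReal_ne_top).trans ?_)
  rw [ENNReal.div_le_iff hepos ENNReal.ofReal_ne_top]
  refine hlin.trans ?_
  rw [he, ← ENNReal.ofReal_mul (by positivity)]
  apply ENNReal.ofReal_le_ofReal
  have hexp : prm.δ / H.card / prm.τ m =
      Real.exp (-(Real.log ((H.card : ℝ) / prm.δ) + Real.log (prm.τ m))) := by
    rw [neg_add, Real.exp_add, Real.exp_neg, Real.exp_neg, Real.exp_log (by positivity),
      Real.exp_log hτ, inv_div, div_eq_mul_inv (prm.δ / _)]
  rw [hexp, ← Real.exp_add]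
  apply Real.exp_le_exp.2
  have hrB : r * prm.τ m / B = 16 * (prm.γ * prm.c₂) *
      (Real.log ((H.card : ℝ) / prm.δ) + Real.log (prm.τ m)) := by
    rw [hr, hBdef, radius, Params.eps]
    field_simp
    ring
  have hgc : 1 ≤ prm.γ * prm.c₂ := by nlinarith
  have h2 : Real.log ((H.card : ℝ) / prm.δ) + Real.log (prm.τ m) ≤ r * prm.τ m / B := by
    rw [hrB]
    nlinarith
  -- The factor `4` in `p > 4r` makes the moment exponent at least `2rτ/B`. Markov's inequality
  -- costs `rτ/B`, and the remaining `rτ/B` dominates `log(|H|/δ) + log τ_m`.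
  have h3 : 2 * (r * prm.τ m / B) ≤ prm.τ m * (𝒟.fst.real {x | h x ≠ hstar x} / (2 * B)) := by
    rw [mul_div_assoc', mul_div_assoc', div_le_div_iff₀ hB (by linarith)]
    nlinarith [mul_pos hτ hB, mul_lt_mul_of_pos_left hp (mul_pos hτ hB)]
  have h4 : 1 / B * (r * prm.τ m) = r * prm.τ m / B := by ring
  rw [h4]
  linarith

/-- A union bound gives `δ/τ_m ≤ 1/τ_m`. If some classifier has large error then `θ ≥ 1`, which
supplies the factor; otherwise the event is empty. Thus no additive term is left when `θ = 0`. -/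
theorem measure_overlooked_le (hsched : prm.ValidSchedule) (hconst : prm.ValidConstants H.card)
    (hmeas : ∀ h ∈ H, Measurable h) (hstar_mem : hstar ∈ H) (hreal : trueErr 𝒟 hstar = 0)
    (hδ : 0 < prm.δ) (hδ1 : prm.δ ≤ 1) (hL : 0 < Real.log ((H.card : ℝ) / prm.δ)) {m : ℕ}
    (h1 : 1 ≤ m) (hm : m ≤ prm.M) :
    ρ (R.Overlooked hstar m)
      ≤ disagreementCoeff 𝒟.fst H hstar * ENNReal.ofReal (1 / prm.τ m) := by
  classical
  have hr := radius_pos hsched hconst hL h1 hm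
  have hH : (0 : ℝ) < H.card := by exact_mod_cast Finset.card_pos.2 ⟨hstar, hstar_mem⟩
  by_cases hex : ∃ h ∈ H, 4 * radius prm H.card m < 𝒟.fst.real {x | h x ≠ hstar x}
  · obtain ⟨h₀, hh₀, hp₀⟩ := hex
    have hθ := one_le_disagreementCoeff hh₀ (show 0 < 𝒟.fst.real {x | h₀ x ≠ hstar x} by linarith)
    have hsub : R.Overlooked hstar m ⊆ ⋃ h ∈ H.filter
        fun h => 4 * radius prm H.card m < 𝒟.fst.real {x | h x ≠ hstar x},
        {ω | R.mistakes hstar m ω h / prm.τ m ≤ radius prm H.card m} := by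
      rintro ω ⟨h, ⟨hh, hle⟩, hp⟩
      exact Set.mem_biUnion (Finset.mem_coe.2 (Finset.mem_filter.2 ⟨hh, hp⟩)) hle
    calc ρ (R.Overlooked hstar m)
        ≤ ∑ h ∈ H.filter fun h => 4 * radius prm H.card m < 𝒟.fst.real {x | h x ≠ hstar x},
            ρ {ω | R.mistakes hstar m ω h / prm.τ m ≤ radius prm H.card m} :=
          (measure_mono hsub).trans (measure_biUnion_finset_le _ _)
      _ ≤ ∑ h ∈ H.filter fun h => 4 * radius prm H.card m < 𝒟.fst.real {x | h x ≠ hstar x},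
            ENNReal.ofReal (prm.δ / H.card / prm.τ m) :=
          Finset.sum_le_sum fun h hh => measure_survives_le hsched hconst hmeas hstar_mem hreal hδ
            hL h1 hm (Finset.mem_filter.1 hh).1 (Finset.mem_filter.1 hh).2
      _ ≤ ∑ h ∈ H, ENNReal.ofReal (prm.δ / H.card / prm.τ m) :=
          Finset.sum_le_sum_of_subset (Finset.filter_subset _ _)
      _ = ENNReal.ofReal (prm.δ / prm.τ m) := by
          rw [Finset.sum_const, nsmul_eq_mul, ← ENNReal.ofReal_natCast,
            ← ENNReal.ofReal_mul hH.le]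
          congr 1
          field_simp
      _ ≤ 1 * ENNReal.ofReal (1 / prm.τ m) := by
          rw [one_mul]
          apply ENNReal.ofReal_le_ofReal
          gcongr
      _ ≤ _ := by gcongr
  · have : R.Overlooked hstar m = ∅ := by
      refine Set.eq_empty_of_forall_notMem fun ω hω => hex ?_
      obtain ⟨h, ⟨hh, _⟩, hp⟩ := hω
      exact ⟨h, hh, hp⟩
    simp [this]

open Classical in
theorem lintegral_card_queried_le (hsched : prm.ValidSchedule)
    (hconst : prm.ValidConstants H.card) (hmeas : ∀ h ∈ H, Measurable h) (hstar_mem : hstar ∈ H)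
    (hreal : trueErr 𝒟 hstar = 0) (hδ : 0 < prm.δ) (hδ1 : prm.δ ≤ 1)
    (hL : 0 < Real.log ((H.card : ℝ) / prm.δ)) {m : ℕ} (h1 : 1 ≤ m) (hm : m < prm.M) {i : ℕ}
    (hi : 1 ≤ i) :
    ∫⁻ ω, ((R.Overlooked hstar m).indicator 1 ω +
        (R.X i ⁻¹' ballRegion 𝒟.fst H hstar (4 * radius prm H.card m)).indicator 1 ω : ℝ≥0∞) ∂ρ
      ≤ disagreementCoeff 𝒟.fst H hstar *
        ENNReal.ofReal (1 / prm.τ m + 4 * radius prm H.card m) := by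
  have hr := radius_pos hsched hconst hL h1 hm.le
  have hO := measurableSet_overlooked (R := R) hsched hmeas hstar_mem hm.le
  have hV := measurableSet_ballRegion (μ := 𝒟.fst) hmeas hstar_mem (4 * radius prm H.card m)
  obtain ⟨i, rfl⟩ := Nat.exists_eq_add_of_le' hi
  have hξ := (R.measurable_example i).mono (R.𝓕.le _) le_rfl
  have hX : Measurable (R.X (i + 1)) := hξ.fst.fst
  have hlaw : ρ.map (R.X (i + 1)) = 𝒟.fst := by
    have : IsProbabilityMeasure (volume.restrict (Set.Icc (0 : ℝ) 1)) := ⟨by simp⟩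
    have e : R.X (i + 1) = Prod.fst ∘ Prod.fst ∘
        fun ω => ((R.X (i + 1) ω, R.Y (i + 1) ω), R.U (i + 1) ω) := rfl
    rw [e, ← Measure.map_map measurable_fst (measurable_fst.comp hξ),
      ← Measure.map_map measurable_fst hξ, R.law_example i]
    change (Measure.fst (𝒟.prod _)).fst = _
    rw [Measure.fst_prod]
  rw [lintegral_add_left (measurable_one.indicator hO), lintegral_indicator_one hO,
    lintegral_indicator_one (hX hV), ← Measure.map_apply hX hV, hlaw,
    ENNReal.ofReal_add (by positivity) (by positivity), mul_add]
  exact add_le_add (measure_overlooked_le hsched hconst hmeas hstar_mem hreal hδ hδ1 hL h1 hm.le)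
    (measure_ballRegion_le (by positivity))

/-- The expected number of queries in terms of the radii. -/
theorem expectedQueries_le_sum (hsched : prm.ValidSchedule)
    (hconst : prm.ValidConstants H.card) (hmeas : ∀ h ∈ H, Measurable h) (hstar_mem : hstar ∈ H)
    (hreal : trueErr 𝒟 hstar = 0) (hδ : 0 < prm.δ) (hδ1 : prm.δ ≤ 1)
    (hL : 0 < Real.log ((H.card : ℝ) / prm.δ)) {k : ℕ} (hk : prm.M = k + 1) :
    R.expectedQueries ≤ 3 + ∑ m ∈ Finset.range k,
      ∑ _i ∈ Finset.Ioc (prm.τ (m + 1)) (prm.τ (m + 2)), disagreementCoeff 𝒟.fst H hstar *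
        ENNReal.ofReal (1 / prm.τ (m + 1) + 4 * radius prm H.card (m + 1)) := by
  classical
  set g : ℕ → ℕ → Ω → ℝ≥0∞ := fun m i ω => (R.Overlooked hstar m).indicator 1 ω +
    (R.X i ⁻¹' ballRegion 𝒟.fst H hstar (4 * radius prm H.card m)).indicator 1 ω with hg
  have hgm : ∀ m i, m ≤ prm.M → 1 ≤ i → Measurable (g m i) := by
    intro m i hm hi
    obtain ⟨i, rfl⟩ := Nat.exists_eq_add_of_le' hi
    have hX : Measurable (R.X (i + 1)) :=
      ((R.measurable_example i).mono (R.𝓕.le _) le_rfl).fst.fst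
    exact (measurable_one.indicator (measurableSet_overlooked hsched hmeas hstar_mem hm)).add
      (measurable_one.indicator (hX (measurableSet_ballRegion hmeas hstar_mem _)))
  have hpt : ∀ᵐ ω ∂ρ, (numQueries prm H (R.path ω) : ℝ≥0∞) ≤ 3 + ∑ m ∈ Finset.range k,
      ∑ i ∈ Finset.Ioc (prm.τ (m + 1)) (prm.τ (m + 2)), g (m + 1) i ω := by
    refine (ae_realized (R := R) hreal).mono fun ω hω => ?_
    -- Index `0` is epoch 1, whose `τ_1 - τ_0 = 3` queries are split off.
    rw [numQueries, hk, Finset.sum_range_succ', add_comm, Nat.cast_add, Nat.cast_sum]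
    refine add_le_add ?_ (Finset.sum_le_sum fun m hm => ?_)
    · have := Finset.card_filter_le (Finset.Ioc (prm.τ 0) (prm.τ (0 + 1)))
        (Queried (R.path ω) (0 + 1) (regionSucc prm H (R.path ω) 0))
      have h3 := this.trans (by rw [Nat.card_Ioc, hsched.zero, zero_add, hsched.one])
      exact_mod_cast h3
    · rw [Finset.mem_range] at hm
      rw [Finset.card_filter, Nat.cast_sum]
      refine Finset.sum_le_sum fun i _ => ?_
      split_ifs with hq
      · rcases mem_of_queried hsched hstar_mem
          (fun m h1 hm => (radius_pos hsched hconst hL h1 hm.le).le) hω (by omega) (by omega) hq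
          with h | h
        · simp [hg, h]
        · simp [hg, h]
      · simp
  refine (lintegral_mono_ae hpt).trans ?_
  rw [lintegral_add_left measurable_const, lintegral_const, measure_univ, mul_one,
    lintegral_finsetSum']
  · refine add_le_add le_rfl (Finset.sum_le_sum fun m hm => ?_)
    rw [Finset.mem_range] at hm
    rw [lintegral_finsetSum']
    · refine Finset.sum_le_sum fun i hi => ?_
      rw [Finset.mem_Ioc] at hi
      exact lintegral_card_queried_le hsched hconst hmeas hstar_mem hreal hδ hδ1 hL (by omega)
        (by omega) (by omega)
    · intro i hi
      rw [Finset.mem_Ioc] at hi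
      exact (hgm _ _ (by omega) (by omega)).aemeasurable
  · intro m hm
    rw [Finset.mem_range] at hm
    refine Finset.aemeasurable_fun_sum _ fun i hi => ?_
    rw [Finset.mem_Ioc] at hi
    exact (hgm _ _ (by omega) (by omega)).aemeasurable

end Run

end

end ActiveCover

theorem mainTheorem6 :
    ∃ C : ℝ, 0 < C ∧
      ∀ {𝒳 : Type*} [MeasurableSpace 𝒳] (𝒟 : Measure (𝒳 × Bool)) [IsProbabilityMeasure 𝒟]
        (H : Finset (𝒳 → Bool)) (_hmeas : ∀ h ∈ H, Measurable h)
        (hstar : 𝒳 → Bool) (_hstar_mem : hstar ∈ H)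
        (_hstar_min : ∀ h ∈ H, ActiveCover.trueErr 𝒟 hstar ≤ ActiveCover.trueErr 𝒟 h)
        (_realizable : ActiveCover.trueErr 𝒟 hstar = 0)
        (prm : ActiveCover.Params) (_hsched : prm.ValidSchedule)
        (_hconst : prm.ValidConstants H.card)
        (_hδ_pos : 0 < prm.δ) (_hδ_lt : prm.δ < 1 / Real.exp 1)
        (_hHδ : Real.sqrt 192 < (H.card : ℝ) / prm.δ)
        {Ω : Type*} [MeasurableSpace Ω] (ρ : Measure Ω) [IsProbabilityMeasure ρ]
        (R : ActiveCover.Run prm H 𝒟 ρ),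
        R.expectedQueries ≤
          3 + ActiveCover.disagreementCoeff 𝒟.fst H hstar *
            ENNReal.ofReal (C * (prm.γ * prm.c₂) *
              (Real.log ((H.card : ℝ) / prm.δ) * Real.log prm.n ^ 2 + Real.log prm.n ^ 3)) := by
  -- `258 = 129 · 2`, from `radius_le` and `sum_ratio_le`.
  refine ⟨258, by norm_num, ?_⟩
  intro 𝒳 _ 𝒟 _ H hmeas hstar hstar_mem _ hreal prm hsched hconst hδ hδ_lt hHδ Ω _ ρ _ R
  have hδ1 : prm.δ ≤ 1 := by
    refine hδ_lt.le.trans ?_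
    rw [div_le_one (Real.exp_pos _)]
    exact Real.one_le_exp zero_le_one
  have hL : 0 < Real.log ((H.card : ℝ) / prm.δ) :=
    Real.log_pos ((Real.one_le_sqrt.2 (by norm_num)).trans_lt hHδ)
  -- Here `k` counts the epochs after the first.
  obtain ⟨k, hk⟩ := Nat.exists_eq_add_of_le' hsched.one_le_M
  refine (ActiveCover.Run.expectedQueries_le_sum hsched hconst hmeas hstar_mem hreal hδ hδ1 hL
    hk).trans ?_
  refine add_le_add le_rfl ?_
  simp only [← Finset.mul_sum]
  refine mul_le_mul' le_rfl ?_
  have hr : ∀ m ∈ Finset.range k,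
      0 ≤ 1 / (prm.τ (m + 1) : ℝ) + 4 * ActiveCover.radius prm H.card (m + 1) := fun m hm => by
    rw [Finset.mem_range] at hm
    have := ActiveCover.radius_pos hsched hconst hL (m := m + 1) (by omega) (by omega)
    positivity
  have hc : ∀ m, ∑ _i ∈ Finset.Ioc (prm.τ (m + 1)) (prm.τ (m + 2)),
      ENNReal.ofReal (1 / prm.τ (m + 1) + 4 * ActiveCover.radius prm H.card (m + 1)) =
      ENNReal.ofReal ((prm.τ (m + 2) - prm.τ (m + 1) : ℕ) *
        (1 / prm.τ (m + 1) + 4 * ActiveCover.radius prm H.card (m + 1))) := fun m => by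
    rw [Finset.sum_const, Nat.card_Ioc, nsmul_eq_mul, ENNReal.ofReal_mul (Nat.cast_nonneg _),
      ENNReal.ofReal_natCast]
  simp only [hc]
  rw [← ENNReal.ofReal_sum_of_nonneg fun m hm => mul_nonneg (Nat.cast_nonneg _) (hr m hm)]
  apply ENNReal.ofReal_le_ofReal
  have hN : 1 ≤ Real.log prm.n := hsched.one_le_log hsched.one_le_M le_rfl
  have hγ := hconst.one_le_gamma
  have hc₂ := hconst.one_le_c₂
  set L := Real.log ((H.card : ℝ) / prm.δ)
  set N := Real.log prm.n with hNdef
  have hsum := hsched.sum_ratio_le (k := k) hk.ge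
  have hn : Real.log (prm.τ (k + 1)) = N := by rw [hNdef, ActiveCover.Params.n, hk]
  rw [hn] at hsum
  have hK : 0 ≤ 129 * (prm.γ * prm.c₂) * ((L + N) * N) := by positivity
  calc _ ≤ ∑ m ∈ Finset.range k, 129 * (prm.γ * prm.c₂) * ((L + N) * N) *
        (((prm.τ (m + 2) - prm.τ (m + 1) : ℕ) : ℝ) / prm.τ (m + 1)) := by
        refine Finset.sum_le_sum fun m hm => ?_
        rw [Finset.mem_range] at hm
        have h := ActiveCover.radius_le hsched hconst hL (m := m + 1) (by omega) (by omega)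
        refine (mul_le_mul_of_nonneg_left h (Nat.cast_nonneg _)).trans (le_of_eq ?_)
        ring
    _ ≤ 129 * (prm.γ * prm.c₂) * ((L + N) * N) * (2 * N) := by
        rw [← Finset.mul_sum]
        exact mul_le_mul_of_nonneg_left hsum hK
    _ = _ := by ring
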